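/- Let $(M_1,g_1)$ and $(M_2,g_2)$ be smooth Riemannian manifolds (without boundary) of dimensions $n\ge 0$ and $m\ge 1$, with $M_2$ non-empty, and let $p,q$ be positive integers. For $i\in\{1,2\}$ let $J_i$ be a smooth $(1,1)$-tensor field on $M_i$ with $J_i^2=pJ_i+qI$ and $g_i(J_iX,Y)=g_i(X,J_iY)$ for all tangent vectors $X,Y$ at the same point (so $(M_i,g_i,J_i)$ is a metallic Riemannian manifold). Let $f>0$ be a smooth function on $M_1$ and let $\widetilde M=M_1\times_f M_2$ be the warped product, i.e. $M_1\times M_2$ with the metric $\widetilde g=p_1^*g_1+(f\circ p_1)^2\,p_2^*g_2$, where $p_1,p_2$ are the projections, and with the structure $\widetilde J(X,Y)=(J_1X,J_2Y)$. The Ricci operator $Q$ of a Riemannian manifold $(M,g)$ with Ricci tensor $S$ is defined by $g(QX,Y)=S(X,Y)$, and for a $(1,1)$-tensor field $J$ on $M$ the Ricci tensor is called $J$-invariant if $Q\circ J=J\circ Q$. Assume that $M_1$ and $M_2$ have $J_1$- and $J_2$-invariant Ricci tensors, respectively. Then $\widetilde M$ has $\widetilde J$-invariant Ricci tensor if and only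 if $$\mathrm{Hess}(f)(J_1X,Y)-\mathrm{Hess}(f)(X,J_1Y)=0$$ for all $x\in M_1$ and all $X,Y\in T_xM_1$, where $\mathrm{Hess}(f)$ is the Hessian of $f$ with respect to the Levi-Civita connection of $g_1$. -/

import Mathlib

set_option maxSynthPendingDepth 3

open Bundle Manifold
open scoped ContDiff

noncomputable section

section Coordinates

/-! ### The Levi-Civita connection, curvature and Ricci tensor of a metric on an open set
of a vector space

`G : E → E →L[ℝ] E →L[ℝ] ℝ` is the field of bilinear forms `z ↦ G z`, written without indices:
`G z u v = ∑ i j, g_ij(z) u^i v^j`. -/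

variable {E : Type*} [NormedAddCommGroup E] [NormedSpace ℝ E]

/-- The Christoffel symbols of the first kind,
`(u, v, w) ↦ (1/2) (∂_u G(v, w) + ∂_v G(u, w) - ∂_w G(u, v))`. -/
def christoffelFirst (G : E → E →L[ℝ] E →L[ℝ] ℝ) (z : E) : E →L[ℝ] E →L[ℝ] E →L[ℝ] ℝ :=
  let D : E →L[ℝ] E →L[ℝ] E →L[ℝ] ℝ := fderiv ℝ G z
  let T : (E →L[ℝ] E →L[ℝ] ℝ) →L[ℝ] (E →L[ℝ] E →L[ℝ] ℝ) :=
    (ContinuousLinearMap.flipₗᵢ ℝ E E ℝ).toContinuousLinearEquiv.toContinuousLinearMap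
  (1 / 2 : ℝ) • (D + D.flip - T.comp D.flip)

theorem christoffelFirst_apply (G : E → E →L[ℝ] E →L[ℝ] ℝ) (z u v w : E) :
    christoffelFirst G z u v w =
      1 / 2 * (fderiv ℝ G z u v w + fderiv ℝ G z v u w - fderiv ℝ G z w u v) := rfl

/-- The Christoffel symbols (of the second kind) of the metric `G`: `Γ(u, v)` is the vector with
`G(Γ(u, v), w) = (1/2) (∂_u G(v, w) + ∂_v G(u, w) - ∂_w G(u, v))` for all `w`, obtained by
inverting `G z : E → E*`. The Levi-Civita connection of `G` is `∇_u W = ∂_u W + Γ(u, W)`. -/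
def christoffel (G : E → E →L[ℝ] E →L[ℝ] ℝ) (z : E) : E →L[ℝ] E →L[ℝ] E :=
  (ContinuousLinearMap.compL ℝ E (E →L[ℝ] ℝ) E (G z).inverse).comp (christoffelFirst G z)

theorem christoffel_apply (G : E → E →L[ℝ] E →L[ℝ] ℝ) (z u v : E) :
    christoffel G z u v = (G z).inverse (christoffelFirst G z u v) := rfl

/-- The endomorphism `u ↦ R(u, v) w`, where
`R(X, Y) Z = ∇_X ∇_Y Z - ∇_Y ∇_X Z - ∇_[X, Y] Z` is the Riemann curvature tensor of `G`;
see `curvatureMap_apply` for the formula. -/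
def curvatureMap (G : E → E →L[ℝ] E →L[ℝ] ℝ) (z v w : E) : E →L[ℝ] E :=
  ((fderiv ℝ (christoffel G) z).flip v).flip w - (fderiv ℝ (christoffel G) z v).flip w +
    (christoffel G z).flip (christoffel G z v w) -
    (christoffel G z v).comp ((christoffel G z).flip w)

theorem curvatureMap_apply (G : E → E →L[ℝ] E →L[ℝ] ℝ) (z u v w : E) :
    curvatureMap G z v w u =
      fderiv ℝ (christoffel G) z u v w - fderiv ℝ (christoffel G) z v u w +
        christoffel G z u (christoffel G z v w) - christoffel G z v (christoffel G z u w) := rfl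

/-- The Ricci tensor of `G`: `S(v, w)` is the trace of `u ↦ R(u, v) w`. -/
def coordRicci [FiniteDimensional ℝ E] (G : E → E →L[ℝ] E →L[ℝ] ℝ) (z v : E) : E →L[ℝ] ℝ :=
  LinearMap.toContinuousLinearMap
    { toFun := fun w => LinearMap.trace ℝ E (curvatureMap G z v w : E →ₗ[ℝ] E)
      map_add' := fun w₁ w₂ => by
        rw [← map_add]
        congr 1
        ext u
        simp only [ContinuousLinearMap.coe_coe, LinearMap.add_apply, curvatureMap_apply, map_add]
        abel
      map_smul' := fun c w => by
        rw [RingHom.id_apply, ← map_smul]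
        congr 1
        ext u
        simp only [ContinuousLinearMap.coe_coe, LinearMap.smul_apply, curvatureMap_apply,
          map_smul, smul_sub, smul_add] }

theorem coordRicci_apply [FiniteDimensional ℝ E] (G : E → E →L[ℝ] E →L[ℝ] ℝ) (z v w : E) :
    coordRicci G z v w = LinearMap.trace ℝ E (curvatureMap G z v w : E →ₗ[ℝ] E) := rfl

/-- The Hessian of `F : E → ℝ` with respect to `G`:
`Hess F (u, v) = ∂_u ∂_v F - (∇_u v) F`, for constant fields `u`, `v`. -/
def coordHessian (G : E → E →L[ℝ] E →L[ℝ] ℝ) (F : E → ℝ) (z u v : E) : ℝ :=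
  fderiv ℝ (fderiv ℝ F) z u v - fderiv ℝ F z (christoffel G z u v)

end Coordinates

section Manifold

variable {E : Type*} [NormedAddCommGroup E] [NormedSpace ℝ E]
  {H : Type*} [TopologicalSpace H] (I : ModelWithCorners ℝ E H)
  {M : Type*} [TopologicalSpace M] [ChartedSpace H M]
  {E' : Type*} [NormedAddCommGroup E'] [NormedSpace ℝ E']
  {H' : Type*} [TopologicalSpace H'] (I' : ModelWithCorners ℝ E' H')
  {M' : Type*} [TopologicalSpace M'] [ChartedSpace H' M']

/-- The pullback `h^* g` of a field of bilinear forms along `h : M' → M`: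
`(h^* g)_x(u, v) = g_{h x}(dh u, dh v)`. -/
def pullbackForm (h : M' → M)
    (g : ∀ x : M, TangentSpace I x →L[ℝ] TangentSpace I x →L[ℝ] ℝ) (x : M') :
    TangentSpace I' x →L[ℝ] TangentSpace I' x →L[ℝ] ℝ :=
  ContinuousLinearMap.bilinearComp (E := E) (F := E) (E' := E') (F' := E')
    (g (h x)) (mfderiv I' I h x) (mfderiv I' I h x)

theorem pullbackForm_apply (h : M' → M)
    (g : ∀ x : M, TangentSpace I x →L[ℝ] TangentSpace I x →L[ℝ] ℝ) (x : M')
    (u v : TangentSpace I' x) :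
    pullbackForm I I' h g x u v = g (h x) (mfderiv I' I h x u) (mfderiv I' I h x v) := rfl

/-- The expression of the metric `g` in the preferred chart at `x`. -/
def coordMetric (g : ∀ x : M, TangentSpace I x →L[ℝ] TangentSpace I x →L[ℝ] ℝ) (x : M) :
    E → E →L[ℝ] E →L[ℝ] ℝ :=
  pullbackForm I 𝓘(ℝ, E) (extChartAt I x).symm g

/-- The Ricci tensor `S` of a metric `g` on a manifold without boundary, computed at the point `x`
in the preferred chart at `x`; `ricciTensor I g x u v = S(u, v)`. -/
def ricciTensor [FiniteDimensional ℝ E]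
    (g : ∀ x : M, TangentSpace I x →L[ℝ] TangentSpace I x →L[ℝ] ℝ) (x : M)
    (u : TangentSpace I x) : TangentSpace I x →L[ℝ] ℝ :=
  (coordRicci (coordMetric I g x) (extChartAt I x x)
    (mfderiv I 𝓘(ℝ, E) (extChartAt I x) x u)).comp (mfderiv I 𝓘(ℝ, E) (extChartAt I x) x)

/-- The Ricci operator `Q`, that is, `g(Q u, v) = S(u, v)`. -/
def ricciOperator [FiniteDimensional ℝ E]
    (g : ∀ x : M, TangentSpace I x →L[ℝ] TangentSpace I x →L[ℝ] ℝ) (x : M)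
    (u : TangentSpace I x) : TangentSpace I x :=
  (g x).inverse (ricciTensor I g x u)

/-- The Ricci tensor of `g` is `J`-invariant: `Q ∘ J = J ∘ Q`. -/
def HasInvariantRicci [FiniteDimensional ℝ E]
    (g : ∀ x : M, TangentSpace I x →L[ℝ] TangentSpace I x →L[ℝ] ℝ)
    (J : ∀ x : M, TangentSpace I x →L[ℝ] TangentSpace I x) : Prop :=
  ∀ (x : M) (u : TangentSpace I x),
    ricciOperator I g x (J x u) = J x (ricciOperator I g x u)

/-- The Hessian `Hess(f)(u, v)`, with respect to the Levi-Civita connection of `g`, of a function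
`f` on a manifold without boundary, computed at `x` in the preferred chart at `x`. -/
def hessian (g : ∀ x : M, TangentSpace I x →L[ℝ] TangentSpace I x →L[ℝ] ℝ) (f : M → ℝ) (x : M)
    (u v : TangentSpace I x) : ℝ :=
  coordHessian (coordMetric I g x) (f ∘ (extChartAt I x).symm) (extChartAt I x x)
    (mfderiv I 𝓘(ℝ, E) (extChartAt I x) x u) (mfderiv I 𝓘(ℝ, E) (extChartAt I x) x v)

/-- `(M, g, J)` is a metallic Riemannian manifold: `g` is a smooth Riemannian metric and `J` is a
smooth `(1,1)`-tensor field with `J² = p J + q I` for positive integers `p`, `q`, such that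
`g(J u, v) = g(u, J v)`. -/
structure IsMetallicRiemannian [IsManifold I ∞ M] (p q : ℕ)
    (g : ContMDiffRiemannianMetric I ∞ E (TangentSpace I : M → Type _))
    (J : ∀ x : M, TangentSpace I x →L[ℝ] TangentSpace I x) : Prop where
  p_ne_zero : p ≠ 0
  q_ne_zero : q ≠ 0
  contMDiff : ContMDiff I (I.prod 𝓘(ℝ, E →L[ℝ] E)) ∞
    (fun x => TotalSpace.mk' (E →L[ℝ] E)
      (E := fun x : M => TangentSpace I x →L[ℝ] TangentSpace I x) x (J x))
  sq : ∀ (x : M) (u : TangentSpace I x), J x (J x u) = (p : ℝ) • J x u + (q : ℝ) • u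
  compatible : ∀ (x : M) (u v : TangentSpace I x), g.inner x (J x u) v = g.inner x u (J x v)

/-- The warped product metric `p₁^* g₁ + (f ∘ p₁)² p₂^* g₂` on `M × M'`. -/
def warpedMetric (g₁ : ∀ x : M, TangentSpace I x →L[ℝ] TangentSpace I x →L[ℝ] ℝ)
    (g₂ : ∀ y : M', TangentSpace I' y →L[ℝ] TangentSpace I' y →L[ℝ] ℝ) (f : M → ℝ)
    (z : M × M') :
    TangentSpace (I.prod I') z →L[ℝ] TangentSpace (I.prod I') z →L[ℝ] ℝ :=
  pullbackForm I (I.prod I') Prod.fst g₁ z +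
    (f z.1) ^ 2 • pullbackForm I' (I.prod I') Prod.snd g₂ z

/-- The tensor field `(J₁, J₂)` on `M × M'`: `(X, Y) ↦ (J₁ X, J₂ Y)`. -/
def prodEndo (J₁ : ∀ x : M, TangentSpace I x →L[ℝ] TangentSpace I x)
    (J₂ : ∀ y : M', TangentSpace I' y →L[ℝ] TangentSpace I' y) (z : M × M') :
    TangentSpace (I.prod I') z →L[ℝ] TangentSpace (I.prod I') z :=
  (J₁ z.1).prodMap (J₂ z.2)

end Manifold

end

noncomputable section

/-! ### Local calculus of one metric on a vector space. -/

section Coordinates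

/-! Since `J` is self-adjoint for a nondegenerate metric, `Q ∘ J = J ∘ Q` says exactly that S(JX, Y)
= S(X, JY) (`ricciOperator_comm_iff`). For the warped product, with m = dim M₂, the Ricci tensor is
S̃(X, Y) = S₁(X₁, Y₁) + S₂(X₂, Y₂) - (m/f) Hess f(X₁, Y₁) + c g₂(X₂, Y₂), where c depends only on
the point. In S̃(J̃X, Y) - S̃(X, J̃Y) the S₁ and S₂ terms cancel by hypothesis and the g₂ term by
self-adjointness of `J₂`. What remains is -(m/f) times the Hessian defect, and m/f ≠ 0.

The work is the formula for S̃. It is computed in a product chart: Christoffel symbols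
(`christoffel_warpedForm`), their derivatives (`fderiv_christoffel_warpedForm`), then the trace of
the curvature (`coordRicci_warpedForm`). It is carried to the manifold by
`ricciTensor_warpedMetric`. -/

theorem LinearMap.trace_prod {V W : Type*} [AddCommGroup V] [Module ℝ V] [AddCommGroup W]
    [Module ℝ W] [Module.Finite ℝ V] [Module.Finite ℝ W] (A : V × W →ₗ[ℝ] V × W) :
    LinearMap.trace ℝ (V × W) A =
      LinearMap.trace ℝ V (LinearMap.fst ℝ V W ∘ₗ A ∘ₗ LinearMap.inl ℝ V W) +
      LinearMap.trace ℝ W (LinearMap.snd ℝ V W ∘ₗ A ∘ₗ LinearMap.inr ℝ V W) := by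
  -- Cyclicity of the trace turns each summand into the trace of a diagonal block.
  have h : A = (A ∘ₗ LinearMap.inl ℝ V W) ∘ₗ LinearMap.fst ℝ V W +
      (A ∘ₗ LinearMap.inr ℝ V W) ∘ₗ LinearMap.snd ℝ V W := by
    ext v <;> simp [← Prod.zero_eq_mk]
  conv_lhs => rw [h]
  rw [map_add, LinearMap.trace_comp_comm', LinearMap.trace_comp_comm' (LinearMap.snd ℝ V W)]

variable {E : Type*} [NormedAddCommGroup E] [NormedSpace ℝ E] [FiniteDimensional ℝ E]

theorem ContinuousLinearMap.isInvertible_of_injective_dual {A : E →L[ℝ] E →L[ℝ] ℝ}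
    (hA : ∀ u, (∀ v, A u v = 0) → u = 0) : A.IsInvertible := by
  have hinj : Function.Injective (A : E →ₗ[ℝ] E →L[ℝ] ℝ) := by
    rw [← LinearMap.ker_eq_bot, LinearMap.ker_eq_bot']
    intro u hu
    exact hA u fun v => by
      simpa using congrArg (fun L : E →L[ℝ] ℝ => L v) hu
  have hdim : Module.finrank ℝ E = Module.finrank ℝ (E →L[ℝ] ℝ) := by
    rw [← (LinearMap.toContinuousLinearMap (𝕜 := ℝ) (E := E) (F' := ℝ)).finrank_eq]
    exact (Subspace.dual_finrank_eq (K := ℝ) (V := E)).symm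
  refine ⟨(LinearEquiv.ofInjectiveOfFinrankEq _ hinj hdim).toContinuousLinearEquiv, ?_⟩
  ext u v
  rfl

variable {G : E → E →L[ℝ] E →L[ℝ] ℝ} {z : E}

theorem contDiffAt_christoffel (hG : ContDiffAt ℝ 2 G z) (hi : (G z).IsInvertible) :
    ContDiffAt ℝ 1 (christoffel G) z := by
  obtain ⟨e, he⟩ := hi
  have hinv : ContDiffAt ℝ 1 (fun z => (G z).inverse) z :=
    ContDiffAt.comp (g := ContinuousLinearMap.inverse) z (by rw [← he]; exact contDiffAt_map_inverse e)
      (hG.of_le (by norm_num))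
  have hD : ContDiffAt ℝ 1 (fderiv ℝ G) z := hG.fderiv_right (by norm_num)
  have hflip : ContDiffAt ℝ 1 (fun z => (fderiv ℝ G z).flip) z :=
    (ContinuousLinearMap.flipₗᵢ ℝ E E (E →L[ℝ] ℝ)).contDiff.contDiffAt.comp z hD
  have hfirst : ContDiffAt ℝ 1 (christoffelFirst G) z := by
    unfold christoffelFirst
    exact ContDiffAt.smul (f := fun _ => (1 / 2 : ℝ)) contDiffAt_const
      ((hD.add hflip).sub (ContDiffAt.clm_comp (g := fun _ => _) contDiffAt_const hflip))
  exact ((ContinuousLinearMap.compL ℝ E (E →L[ℝ] ℝ) E).contDiff.contDiffAt.comp z hinv).clm_comp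
    hfirst

omit [FiniteDimensional ℝ E] in
theorem apply_christoffel (hi : (G z).IsInvertible) (u v : E) :
    G z (christoffel G z u v) = christoffelFirst G z u v := by
  rw [christoffel_apply, hi.self_apply_inverse]

omit [FiniteDimensional ℝ E] in
theorem fderiv_apply_symm (hG : DifferentiableAt ℝ G z) (hs : ∀ z u v, G z u v = G z v u)
    (k u v : E) : fderiv ℝ G z k u v = fderiv ℝ G z k v u := by
  have h (u v : E) : fderiv ℝ (fun z => G z u v) z k = fderiv ℝ G z k u v := by
    have := (hG.hasFDerivAt.clm_apply (hasFDerivAt_const u z)).clm_apply (hasFDerivAt_const v z)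
    rw [this.fderiv]; simp
  rw [← h, ← h]
  simp_rw [hs _ u v]

omit [FiniteDimensional ℝ E] in
theorem christoffel_symm (hG : DifferentiableAt ℝ G z) (hs : ∀ z u v, G z u v = G z v u)
    (u v : E) : christoffel G z u v = christoffel G z v u := by
  rw [christoffel_apply, christoffel_apply]
  congr 1
  ext w
  rw [christoffelFirst_apply, christoffelFirst_apply, fderiv_apply_symm hG hs w u v]
  ring

theorem fderiv_christoffel_apply (hG : ContDiffAt ℝ 2 G z) (hi : (G z).IsInvertible)
    (k u v : E) :
    fderiv ℝ (christoffel G) z k u v = fderiv ℝ (fun z => christoffel G z u v) z k := by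
  have hd := ((contDiffAt_christoffel hG hi).differentiableAt (by norm_num)).hasFDerivAt
  rw [((hd.clm_apply (hasFDerivAt_const u z)).clm_apply (hasFDerivAt_const v z)).fderiv]
  simp

omit [FiniteDimensional ℝ E] in
theorem christoffel_eventuallyEq {G₁ G₂ : E → E →L[ℝ] E →L[ℝ] ℝ} (h : G₁ =ᶠ[nhds z] G₂) :
    christoffel G₁ =ᶠ[nhds z] christoffel G₂ := by
  filter_upwards [h, h.fderiv (𝕜 := ℝ)] with y hy hy'
  simp only [christoffel, christoffelFirst, hy, hy']

/-- Ricci depends only on the germ of the metric; chart expressions are controlled only on the chart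
target. -/
theorem coordRicci_congr {G₁ G₂ : E → E →L[ℝ] E →L[ℝ] ℝ} (h : G₁ =ᶠ[nhds z] G₂) :
    coordRicci G₁ z = coordRicci G₂ z := by
  ext v w
  rw [coordRicci_apply, coordRicci_apply]
  congr 2
  unfold curvatureMap
  rw [(christoffel_eventuallyEq h).fderiv_eq, (christoffel_eventuallyEq h).eq_of_nhds]

omit [FiniteDimensional ℝ E] in
theorem eventually_isInvertible [CompleteSpace E] (hG : ContinuousAt G z)
    (hi : (G z).IsInvertible) : ∀ᶠ y in nhds z, (G y).IsInvertible := by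
  obtain ⟨e, he⟩ := hi
  have h := e.nhds
  rw [he] at h
  exact hG h

/-- In finite dimension a basis of `E` identifies `E →L[ℝ] W` with a finite power of `W`, each
component being evaluation at a vector. -/
theorem contDiffAt_clm_apply_iff {D W : Type*} [NormedAddCommGroup D] [NormedSpace ℝ D]
    [NormedAddCommGroup W] [NormedSpace ℝ W] {n : ℕ∞ω} {h : D → E →L[ℝ] W} {x : D} :
    ContDiffAt ℝ n h x ↔ ∀ y, ContDiffAt ℝ n (fun z => h z y) x := by
  refine ⟨fun hh y => hh.clm_apply contDiffAt_const, fun hh => ?_⟩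
  let d := Module.finrank ℝ E
  have hd : d = Module.finrank ℝ (Fin d → ℝ) := Module.finrank_fin_fun ℝ |>.symm
  let e₁ := ContinuousLinearEquiv.ofFinrankEq hd
  let e₂ := (e₁.arrowCongr (1 : W ≃L[ℝ] W)).trans (ContinuousLinearEquiv.piRing (Fin d))
  rw [← Function.id_comp h, ← e₂.symm_comp_self]
  exact e₂.symm.contDiff.contDiffAt.comp x (contDiffAt_pi.mpr fun i => hh _)

/-! ### Warped products of metrics on vector spaces. -/

section Warped

variable {E' : Type*} [NormedAddCommGroup E'] [NormedSpace ℝ E'] [FiniteDimensional ℝ E']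

/-- The warped product of two fields of bilinear forms on vector spaces. -/
def warpedForm (G : E → E →L[ℝ] E →L[ℝ] ℝ) (G' : E' → E' →L[ℝ] E' →L[ℝ] ℝ) (F : E → ℝ)
    (z : E × E') : (E × E') →L[ℝ] (E × E') →L[ℝ] ℝ :=
  (G z.1).bilinearComp (ContinuousLinearMap.fst ℝ E E') (ContinuousLinearMap.fst ℝ E E') +
    F z.1 ^ 2 •
      (G' z.2).bilinearComp (ContinuousLinearMap.snd ℝ E E') (ContinuousLinearMap.snd ℝ E E')

omit [FiniteDimensional ℝ E] [FiniteDimensional ℝ E'] in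
theorem warpedForm_apply (G : E → E →L[ℝ] E →L[ℝ] ℝ) (G' : E' → E' →L[ℝ] E' →L[ℝ] ℝ)
    (F : E → ℝ) (z u v : E × E') :
    warpedForm G G' F z u v = G z.1 u.1 v.1 + F z.1 ^ 2 * G' z.2 u.2 v.2 := rfl

/-- The gradient of `F` with respect to `G`. -/
def coordGradient (G : E → E →L[ℝ] E →L[ℝ] ℝ) (F : E → ℝ) (z : E) : E :=
  (G z).inverse (fderiv ℝ F z)

variable {G' : E' → E' →L[ℝ] E' →L[ℝ] ℝ} {F : E → ℝ} {z : E × E'}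

theorem isInvertible_warpedForm (hi : (G z.1).IsInvertible) (hi' : (G' z.2).IsInvertible)
    (hF : F z.1 ≠ 0) : (warpedForm G G' F z).IsInvertible := by
  refine ContinuousLinearMap.isInvertible_of_injective_dual fun u hu => ?_
  ext1
  · refine hi.injective ?_
    ext v
    simpa [warpedForm_apply] using hu (v, 0)
  · refine hi'.injective ?_
    ext v
    simpa [warpedForm_apply, hF] using hu (0, v)

theorem contDiffAt_warpedForm (hG : ContDiffAt ℝ 2 G z.1) (hG' : ContDiffAt ℝ 2 G' z.2)
    (hF : ContDiffAt ℝ 2 F z.1) : ContDiffAt ℝ 2 (warpedForm G G' F) z := by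
  have h1 : ContDiffAt ℝ 2 (fun z : E × E' => G z.1) z := hG.comp z contDiffAt_fst
  have h2 : ContDiffAt ℝ 2 (fun z : E × E' => G' z.2) z := hG'.comp z contDiffAt_snd
  have h3 : ContDiffAt ℝ 2 (fun z : E × E' => F z.1) z := hF.comp z contDiffAt_fst
  rw [contDiffAt_clm_apply_iff]
  intro u
  rw [contDiffAt_clm_apply_iff]
  intro v
  simp only [warpedForm_apply]
  exact ((h1.clm_apply contDiffAt_const).clm_apply contDiffAt_const).add
    ((h3.pow 2).mul ((h2.clm_apply contDiffAt_const).clm_apply contDiffAt_const))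

omit [FiniteDimensional ℝ E] [FiniteDimensional ℝ E'] in
theorem fderiv_warpedForm_apply (hG : DifferentiableAt ℝ G z.1) (hG' : DifferentiableAt ℝ G' z.2)
    (hF : DifferentiableAt ℝ F z.1) (hW : DifferentiableAt ℝ (warpedForm G G' F) z)
    (k u v : E × E') :
    fderiv ℝ (warpedForm G G' F) z k u v = fderiv ℝ G z.1 k.1 u.1 v.1 +
      2 * F z.1 * fderiv ℝ F z.1 k.1 * G' z.2 u.2 v.2 +
      F z.1 ^ 2 * fderiv ℝ G' z.2 k.2 u.2 v.2 := by
  have h := ((hW.hasFDerivAt.clm_apply (hasFDerivAt_const u z)).clm_apply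
    (hasFDerivAt_const v z)).fderiv
  have h1 : HasFDerivAt (fun z : E × E' => G z.1) _ z := hG.hasFDerivAt.comp z hasFDerivAt_fst
  have h2 : HasFDerivAt (fun z : E × E' => G' z.2) _ z := hG'.hasFDerivAt.comp z hasFDerivAt_snd
  have h3 : HasFDerivAt (fun z : E × E' => F z.1) _ z := hF.hasFDerivAt.comp z hasFDerivAt_fst
  have h' := (((h1.clm_apply (hasFDerivAt_const u.1 z)).clm_apply (hasFDerivAt_const v.1 z)).add
    ((h3.pow 2).mul
      ((h2.clm_apply (hasFDerivAt_const u.2 z)).clm_apply (hasFDerivAt_const v.2 z)))).fderiv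
  have e := congrArg (fun L : E × E' →L[ℝ] ℝ => L k) (h.symm.trans h')
  simp at e
  rw [e]
  ring

/-- Lowering the index with the invertible warped form reduces this to Christoffel symbols of the
first kind. The gradient and dF/F terms come from differentiating the factor F². -/
theorem christoffel_warpedForm (hG : ContDiffAt ℝ 2 G z.1) (hG' : ContDiffAt ℝ 2 G' z.2)
    (hF : ContDiffAt ℝ 2 F z.1) (hi : (G z.1).IsInvertible) (hi' : (G' z.2).IsInvertible)
    (hF0 : F z.1 ≠ 0) (u v : E × E') :
    christoffel (warpedForm G G' F) z u v =
      (christoffel G z.1 u.1 v.1 - (F z.1 * G' z.2 u.2 v.2) • coordGradient G F z.1,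
        christoffel G' z.2 u.2 v.2 + (fderiv ℝ F z.1 u.1 / F z.1) • v.2 +
          (fderiv ℝ F z.1 v.1 / F z.1) • u.2) := by
  have hiW := isInvertible_warpedForm hi hi' hF0
  refine hiW.injective ?_
  rw [apply_christoffel hiW]
  refine ContinuousLinearMap.ext fun w => ?_
  have two : (2 : ℕ∞ω) ≠ 0 := by norm_num
  have d := fderiv_warpedForm_apply (hG.differentiableAt two) (hG'.differentiableAt two)
    (hF.differentiableAt two) ((contDiffAt_warpedForm hG hG' hF).differentiableAt two)
  have hgrad : G z.1 (coordGradient G F z.1) = fderiv ℝ F z.1 := hi.self_apply_inverse _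
  rw [christoffelFirst_apply, d, d, d, warpedForm_apply]
  simp only [map_add, map_sub, map_smul, add_apply,
    sub_apply, smul_apply, hgrad, apply_christoffel hi,
    apply_christoffel hi', christoffelFirst_apply, smul_eq_mul]
  field_simp
  ring

theorem contDiffAt_coordGradient {z : E} (hG : ContDiffAt ℝ 2 G z) (hF : ContDiffAt ℝ 2 F z)
    (hi : (G z).IsInvertible) : ContDiffAt ℝ 1 (coordGradient G F) z := by
  obtain ⟨e, he⟩ := hi
  have hinv : ContDiffAt ℝ 1 (fun z => (G z).inverse) z :=
    ContDiffAt.comp (g := ContinuousLinearMap.inverse) z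
      (by rw [← he]; exact contDiffAt_map_inverse e) (hG.of_le (by norm_num))
  exact hinv.clm_apply (hF.fderiv_right (by norm_num))

theorem fderiv_christoffel_warpedForm (hG : ContDiffAt ℝ 2 G z.1) (hG' : ContDiffAt ℝ 2 G' z.2)
    (hF : ContDiffAt ℝ 2 F z.1) (hi : (G z.1).IsInvertible) (hi' : (G' z.2).IsInvertible)
    (hF0 : F z.1 ≠ 0) (k u v : E × E') :
    fderiv ℝ (christoffel (warpedForm G G' F)) z k u v =
      (fderiv ℝ (christoffel G) z.1 k.1 u.1 v.1
        - (fderiv ℝ F z.1 k.1 * G' z.2 u.2 v.2 + F z.1 * fderiv ℝ G' z.2 k.2 u.2 v.2) •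
          coordGradient G F z.1
        - (F z.1 * G' z.2 u.2 v.2) • fderiv ℝ (coordGradient G F) z.1 k.1,
      fderiv ℝ (christoffel G') z.2 k.2 u.2 v.2
        + (fderiv ℝ (fderiv ℝ F) z.1 k.1 u.1 / F z.1
          - fderiv ℝ F z.1 k.1 * fderiv ℝ F z.1 u.1 / F z.1 ^ 2) • v.2
        + (fderiv ℝ (fderiv ℝ F) z.1 k.1 v.1 / F z.1
          - fderiv ℝ F z.1 k.1 * fderiv ℝ F z.1 v.1 / F z.1 ^ 2) • u.2) := by
  rw [fderiv_christoffel_apply (contDiffAt_warpedForm hG hG' hF)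
    (isInvertible_warpedForm hi hi' hF0)]
  have two : (2 : ℕ∞ω) ≠ 0 := by norm_num
  have fst : Filter.Tendsto Prod.fst (nhds z) (nhds z.1) := continuous_fst.continuousAt
  have snd : Filter.Tendsto Prod.snd (nhds z) (nhds z.2) := continuous_snd.continuousAt
  -- Differentiation needs the formula near `z`, not just at `z`; invertibility, smoothness and F ≠
  -- 0 persist nearby. Quotients are written with inverses to fit the product rule.
  have hev : (fun y => christoffel (warpedForm G G' F) y u v) =ᶠ[nhds z] fun y =>
      (christoffel G y.1 u.1 v.1 - (F y.1 * G' y.2 u.2 v.2) • coordGradient G F y.1,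
        christoffel G' y.2 u.2 v.2 + (fderiv ℝ F y.1 u.1 * (F y.1)⁻¹) • v.2 +
          (fderiv ℝ F y.1 v.1 * (F y.1)⁻¹) • u.2) := by
    filter_upwards [fst.eventually (hG.eventually (by simp)),
      snd.eventually (hG'.eventually (by simp)), fst.eventually (hF.eventually (by simp)),
      fst.eventually (eventually_isInvertible hG.continuousAt hi),
      snd.eventually (eventually_isInvertible hG'.continuousAt hi'),
      fst.eventually (hF.continuousAt.eventually_ne hF0)] with y h1 h2 h3 h4 h5 h6
    simp only [christoffel_warpedForm h1 h2 h3 h4 h5 h6 u v, div_eq_mul_inv]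
  rw [hev.fderiv_eq]
  have dC : HasFDerivAt (fun y : E × E' => christoffel G y.1) _ z :=
    ((contDiffAt_christoffel hG hi).differentiableAt one_ne_zero).hasFDerivAt.comp z hasFDerivAt_fst
  have dC' : HasFDerivAt (fun y : E × E' => christoffel G' y.2) _ z :=
    ((contDiffAt_christoffel hG' hi').differentiableAt one_ne_zero).hasFDerivAt.comp z
      hasFDerivAt_snd
  have dF : HasFDerivAt (fun y : E × E' => F y.1) _ z :=
    (hF.differentiableAt two).hasFDerivAt.comp z hasFDerivAt_fst
  have dDF : HasFDerivAt (fun y : E × E' => fderiv ℝ F y.1) _ z :=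
    ((hF.fderiv_right (m := 1) (by norm_num)).differentiableAt one_ne_zero).hasFDerivAt.comp z
      hasFDerivAt_fst
  have dG' : HasFDerivAt (fun y : E × E' => G' y.2) _ z :=
    (hG'.differentiableAt two).hasFDerivAt.comp z hasFDerivAt_snd
  have dgrad : HasFDerivAt (fun y : E × E' => coordGradient G F y.1) _ z :=
    ((contDiffAt_coordGradient hG hF hi).differentiableAt one_ne_zero).hasFDerivAt.comp z
      hasFDerivAt_fst
  have dinv : HasFDerivAt (fun y : E × E' => (F y.1)⁻¹) _ z :=
    (hasDerivAt_inv hF0).comp_hasFDerivAt z dF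
  have c (w : E) := hasFDerivAt_const (𝕜 := ℝ) w z
  have c' (w : E') := hasFDerivAt_const (𝕜 := ℝ) w z
  have h := ((((dC.clm_apply (c u.1)).clm_apply (c v.1)).sub
    ((dF.mul ((dG'.clm_apply (c' u.2)).clm_apply (c' v.2))).smul dgrad)).prodMk
    ((((dC'.clm_apply (c' u.2)).clm_apply (c' v.2)).add
      (((dDF.clm_apply (c u.1)).mul dinv).smul (c' v.2))).add
      (((dDF.clm_apply (c v.1)).mul dinv).smul (c' u.2)))).fderiv
  refine (congrArg (fun L : E × E' →L[ℝ] E × E' => L k) h).trans ?_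
  ext1
  · simp
    module
  · simp
    module

/-- Only the two diagonal blocks of u ↦ R(u, v)w contribute to its trace. The value of `c` is left
implicit because its term is a multiple of `G'`, for which `J₂` is self-adjoint. -/
theorem coordRicci_warpedForm (hG : ContDiffAt ℝ 2 G z.1) (hG' : ContDiffAt ℝ 2 G' z.2)
    (hF : ContDiffAt ℝ 2 F z.1) (hi : (G z.1).IsInvertible) (hi' : (G' z.2).IsInvertible)
    (hs : ∀ z u v, G' z u v = G' z v u) (hF0 : F z.1 ≠ 0) :
    ∃ c : ℝ, ∀ v w : E × E', coordRicci (warpedForm G G' F) z v w =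
      coordRicci G z.1 v.1 w.1 + coordRicci G' z.2 v.2 w.2
        - Module.finrank ℝ E' / F z.1 * coordHessian G F z.1 v.1 w.1 + c * G' z.2 v.2 w.2 := by
  have two : (2 : ℕ∞ω) ≠ 0 := by norm_num
  set N : ℝ := fderiv ℝ F z.1 (coordGradient G F z.1) with hN
  -- This is u ↦ ∇_u grad F, whose trace is the Laplacian of F; `N` is |grad F|².
  set A : E →L[ℝ] E := fderiv ℝ (coordGradient G F) z.1 +
    (christoffel G z.1).flip (coordGradient G F z.1) with hA
  have hsymm := christoffel_symm (hG'.differentiableAt two) hs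
  have hΓ := christoffel_warpedForm hG hG' hF hi hi' hF0
  have hdΓ := fderiv_christoffel_warpedForm hG hG' hF hi hi' hF0
  -- The Laplacian comes from `block₁`. In `block₂` the identity contributes -dim E' · N and the
  -- rank-one term +N.
  refine ⟨-F z.1 * LinearMap.trace ℝ E A - (Module.finrank ℝ E' - 1) * N, fun v w => ?_⟩
  have block₁ : LinearMap.fst ℝ E E' ∘ₗ (curvatureMap (warpedForm G G' F) z v w : _ →ₗ[ℝ] _) ∘ₗ
      LinearMap.inl ℝ E E' =
      (curvatureMap G z.1 v.1 w.1 : E →ₗ[ℝ] E) - (F z.1 * G' z.2 v.2 w.2) • (A : E →ₗ[ℝ] E) := by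
    ext u
    simp only [LinearMap.comp_apply, LinearMap.fst_apply, LinearMap.inl_apply,
      ContinuousLinearMap.coe_coe, curvatureMap_apply, hΓ, hdΓ, LinearMap.sub_apply,
      LinearMap.smul_apply, hA, add_apply, ContinuousLinearMap.flip_apply, map_zero, map_sub, map_smul, map_add, zero_apply, smul_eq_mul]
    match_scalars <;> field_simp <;> ring
  have block₂ : LinearMap.snd ℝ E E' ∘ₗ (curvatureMap (warpedForm G G' F) z v w : _ →ₗ[ℝ] _) ∘ₗ
      LinearMap.inr ℝ E E' =
      (curvatureMap G' z.2 v.2 w.2 : E' →ₗ[ℝ] E') -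
        (coordHessian G F z.1 v.1 w.1 / F z.1 + N * G' z.2 v.2 w.2) • LinearMap.id +
        N • (G' z.2 w.2 : E' →ₗ[ℝ] ℝ).smulRight v.2 := by
    ext u
    simp only [LinearMap.comp_apply, LinearMap.snd_apply, LinearMap.inr_apply,
      ContinuousLinearMap.coe_coe, curvatureMap_apply, hΓ, hdΓ, LinearMap.sub_apply,
      LinearMap.smul_apply, LinearMap.add_apply, LinearMap.smulRight_apply, LinearMap.id_apply,
      map_zero, map_sub, map_smul, map_add, zero_apply, smul_eq_mul,
      coordHessian, hsymm v.2 u, hs z.2 w.2 u, ← hN]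
    match_scalars <;> field_simp <;> ring
  rw [coordRicci_apply, LinearMap.trace_prod, block₁, block₂]
  simp only [map_add, map_sub, map_smul, LinearMap.trace_id, LinearMap.trace_smulRight,
    coordRicci_apply, ContinuousLinearMap.coe_coe, smul_eq_mul, hs z.2 w.2 v.2]
  field_simp
  ring

end Warped

end Coordinates

/-! ### Metric, Ricci tensor and Hessian read in preferred charts. -/

section Manifold

variable {E : Type*} [NormedAddCommGroup E] [NormedSpace ℝ E] [FiniteDimensional ℝ E]
  {H : Type*} [TopologicalSpace H] {I : ModelWithCorners ℝ E H} [I.Boundaryless]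
  {M : Type*} [TopologicalSpace M] [ChartedSpace H M]

omit [FiniteDimensional ℝ E] in
theorem mdifferentiableAt_extChartAt_symm [IsManifold I 1 M] {x : M} {z : E}
    (hz : z ∈ (extChartAt I x).target) :
    MDifferentiableAt 𝓘(ℝ, E) I (extChartAt I x).symm z := by
  have h := mdifferentiableWithinAt_extChartAt_symm (I := I) hz
  rwa [I.range_eq_univ, mdifferentiableWithinAt_univ] at h

omit [FiniteDimensional ℝ E] in
theorem mfderiv_extChartAt_symm_injective [IsManifold I 1 M] {x : M} {z : E}
    (hz : z ∈ (extChartAt I x).target) :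
    Function.Injective (mfderiv 𝓘(ℝ, E) I (extChartAt I x).symm z) := by
  have h := isInvertible_mfderivWithin_extChartAt_symm (I := I) hz
  rw [I.range_eq_univ, mfderivWithin_univ] at h
  exact h.injective

omit [FiniteDimensional ℝ E] [I.Boundaryless] in
theorem coordMetric_apply (g : ∀ x : M, TangentSpace I x →L[ℝ] TangentSpace I x →L[ℝ] ℝ) (x : M)
    (z u v : E) : coordMetric I g x z u v = g ((extChartAt I x).symm z)
      (mfderiv 𝓘(ℝ, E) I (extChartAt I x).symm z u)
      (mfderiv 𝓘(ℝ, E) I (extChartAt I x).symm z v) := rfl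

theorem isInvertible_coordMetric [IsManifold I 1 M]
    {g : ∀ x : M, TangentSpace I x →L[ℝ] TangentSpace I x →L[ℝ] ℝ}
    (hg : ∀ x u, u ≠ 0 → 0 < g x u u) {x : M} {z : E} (hz : z ∈ (extChartAt I x).target) :
    (coordMetric I g x z).IsInvertible := by
  refine ContinuousLinearMap.isInvertible_of_injective_dual fun u hu => ?_
  by_contra h0
  refine (hg _ (mfderiv 𝓘(ℝ, E) I (extChartAt I x).symm z u) fun h => h0 ?_).ne' (hu u)
  exact mfderiv_extChartAt_symm_injective hz (h.trans (map_zero _).symm)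

theorem contDiffAt_coordMetric [IsManifold I ∞ M]
    (g : ContMDiffRiemannianMetric I ∞ E (TangentSpace I : M → Type _)) {x : M} {z : E}
    (hz : z ∈ (extChartAt I x).target) : ContDiffAt ℝ ∞ (coordMetric I g.inner x) z := by
  have hopen : IsOpen (extChartAt I x).target := isOpen_extChartAt_target x
  have hsymm := contMDiffOn_extChartAt_symm (I := I) (n := ∞) x
  -- Coordinate vector fields are smooth along the inverse chart, as images of constant fields under
  -- its tangent map.
  have hvec (u : E) : ContMDiffAt 𝓘(ℝ, E) (I.prod 𝓘(ℝ, E)) ∞ (fun z => TotalSpace.mk' E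
      (E := (TangentSpace I : M → Type _)) ((extChartAt I x).symm z)
      (mfderiv 𝓘(ℝ, E) I (extChartAt I x).symm z u)) z := by
    have h1 := hsymm.contMDiffOn_tangentMapWithin (m := ∞) (by simp) hopen.uniqueMDiffOn
    have h2 : ContMDiff 𝓘(ℝ, E) (𝓘(ℝ, E).prod 𝓘(ℝ, E)) ∞ (fun z => TotalSpace.mk' E
      (E := (TangentSpace 𝓘(ℝ, E) : E → Type _)) z u) :=
      contMDiff_vectorSpace_iff_contDiff (V := fun _ => u) |>.mpr contDiff_const
    have h3 := (h1.comp h2.contMDiffOn (fun y (hy : y ∈ (extChartAt I x).target) => hy)).contMDiffAt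
      (hopen.mem_nhds hz)
    refine h3.congr_of_eventuallyEq ?_
    filter_upwards [hopen.mem_nhds hz] with y hy
    simp only [Function.comp_apply, tangentMapWithin, mfderivWithin_of_isOpen hopen hy]
  rw [contDiffAt_clm_apply_iff]
  intro u
  rw [contDiffAt_clm_apply_iff]
  intro v
  have hg : ContMDiffAt 𝓘(ℝ, E) (I.prod 𝓘(ℝ, E →L[ℝ] E →L[ℝ] ℝ)) ∞
      (fun z => TotalSpace.mk' (E →L[ℝ] E →L[ℝ] ℝ)
        (E := fun x : M => TangentSpace I x →L[ℝ] TangentSpace I x →L[ℝ] ℝ)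
        ((extChartAt I x).symm z) (g.inner ((extChartAt I x).symm z))) z :=
    g.contMDiff.contMDiffAt.comp z (hsymm.contMDiffAt (hopen.mem_nhds hz))
  have h : ContMDiffAt 𝓘(ℝ, E) (I.prod 𝓘(ℝ)) ∞
      (fun z => TotalSpace.mk' ℝ (E := Bundle.Trivial M ℝ) ((extChartAt I x).symm z)
        (coordMetric I g.inner x z u v)) z :=
    ContMDiffAt.clm_bundle_apply₂ (F₁ := E) (F₂ := E) hg (hvec u) (hvec v)
  rw [contMDiffAt_totalSpace] at h
  exact h.2.contDiffAt

omit [I.Boundaryless] in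
-- The derivative of the preferred chart at its own base point is the identity, so tangent vectors
-- at `x` are already coordinate vectors.
theorem ricciTensor_apply [IsManifold I 1 M]
    (g : ∀ x : M, TangentSpace I x →L[ℝ] TangentSpace I x →L[ℝ] ℝ) (x : M)
    (u v : TangentSpace I x) :
    ricciTensor I g x u v = coordRicci (coordMetric I g x) (extChartAt I x x) u v := by
  unfold ricciTensor
  rw [mfderiv_extChartAt_self]
  rfl

omit [FiniteDimensional ℝ E] [I.Boundaryless] in
theorem hessian_apply [IsManifold I 1 M]
    (g : ∀ x : M, TangentSpace I x →L[ℝ] TangentSpace I x →L[ℝ] ℝ) (f : M → ℝ) (x : M)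
    (u v : TangentSpace I x) :
    hessian I g f x u v = coordHessian (coordMetric I g x) (f ∘ (extChartAt I x).symm)
      (extChartAt I x x) u v := by
  unfold hessian
  rw [mfderiv_extChartAt_self]
  rfl

omit [I.Boundaryless] in
theorem ricciOperator_comm_iff {g : ∀ x : M, TangentSpace I x →L[ℝ] TangentSpace I x →L[ℝ] ℝ}
    {J : ∀ x : M, TangentSpace I x →L[ℝ] TangentSpace I x} {x : M}
    (hg : ∀ u, (∀ v, g x u v = 0) → u = 0) (hJ : ∀ u v, g x (J x u) v = g x u (J x v)) :
    (∀ u, ricciOperator I g x (J x u) = J x (ricciOperator I g x u)) ↔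
      ∀ u v, ricciTensor I g x (J x u) v = ricciTensor I g x u (J x v) := by
  have hi : (g x).IsInvertible :=
    ContinuousLinearMap.isInvertible_of_injective_dual (E := E) hg
  have hQ (u v) : g x (ricciOperator I g x u) v = ricciTensor I g x u v := by
    rw [ricciOperator, hi.self_apply_inverse]
  refine forall_congr' fun u => ⟨fun h v => ?_, fun h => hi.injective ?_⟩
  · rw [← hQ, h, hJ, hQ]
  · ext v
    rw [hQ, hJ, hQ, h]

variable {E' : Type*} [NormedAddCommGroup E'] [NormedSpace ℝ E'] [FiniteDimensional ℝ E']
  {H' : Type*} [TopologicalSpace H'] {I' : ModelWithCorners ℝ E' H'} [I'.Boundaryless]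
  {M' : Type*} [TopologicalSpace M'] [ChartedSpace H' M']

omit [FiniteDimensional ℝ E] [I.Boundaryless] [FiniteDimensional ℝ E'] [I'.Boundaryless] in
theorem warpedMetric_apply (g₁ : ∀ x : M, TangentSpace I x →L[ℝ] TangentSpace I x →L[ℝ] ℝ)
    (g₂ : ∀ y : M', TangentSpace I' y →L[ℝ] TangentSpace I' y →L[ℝ] ℝ) (f : M → ℝ)
    (z : M × M') (u v : TangentSpace (I.prod I') z) :
    warpedMetric I I' g₁ g₂ f z u v = g₁ z.1 u.1 v.1 + f z.1 ^ 2 * g₂ z.2 u.2 v.2 := by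
  have h : warpedMetric I I' g₁ g₂ f z u v =
    pullbackForm I (I.prod I') Prod.fst g₁ z u v +
    f z.1 ^ 2 * pullbackForm I' (I.prod I') Prod.snd g₂ z u v := rfl
  rw [h, pullbackForm_apply, pullbackForm_apply, mfderiv_fst, mfderiv_snd]
  rfl

omit [FiniteDimensional ℝ E] [FiniteDimensional ℝ E'] in
theorem coordMetric_warpedMetric [IsManifold I 1 M] [IsManifold I' 1 M']
    (g₁ : ∀ x : M, TangentSpace I x →L[ℝ] TangentSpace I x →L[ℝ] ℝ)
    (g₂ : ∀ y : M', TangentSpace I' y →L[ℝ] TangentSpace I' y →L[ℝ] ℝ) (f : M → ℝ)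
    (x : M × M') {z : E × E'} (hz₁ : z.1 ∈ (extChartAt I x.1).target)
    (hz₂ : z.2 ∈ (extChartAt I' x.2).target) :
    coordMetric (I.prod I') (warpedMetric I I' g₁ g₂ f) x z =
      warpedForm (coordMetric I g₁ x.1) (coordMetric I' g₂ x.2)
        (f ∘ (extChartAt I x.1).symm) z := by
  have hd : mfderiv 𝓘(ℝ, E × E') (I.prod I') (extChartAt (I.prod I') x).symm z =
      (mfderiv 𝓘(ℝ, E) I (extChartAt I x.1).symm z.1).prodMap
        (mfderiv 𝓘(ℝ, E') I' (extChartAt I' x.2).symm z.2) := by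
    have h := mfderiv_prodMap (p := z) (mdifferentiableAt_extChartAt_symm (I := I) hz₁)
      (mdifferentiableAt_extChartAt_symm (I := I') hz₂)
    -- This reconciles the product of the model structures on `E` and `E'` with the model structure
    -- on `E × E'`.
    rw [← modelWithCornersSelf_prod, chartedSpaceSelf_prod] at h
    rw [extChartAt_prod]
    exact h
  refine ContinuousLinearMap.ext fun u => ContinuousLinearMap.ext fun v => ?_
  rw [coordMetric_apply, warpedMetric_apply, hd, warpedForm_apply]
  rw [extChartAt_prod]
  rfl

end Manifold

/-! ### The Ricci tensor of a warped product manifold. -/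

section Manifold

variable {E : Type*} [NormedAddCommGroup E] [NormedSpace ℝ E]
  {H : Type*} [TopologicalSpace H] {I : ModelWithCorners ℝ E H} [I.Boundaryless]
  {M : Type*} [TopologicalSpace M] [ChartedSpace H M]

theorem coordMetric_extChartAt_self [IsManifold I 1 M]
    (g : ∀ x : M, TangentSpace I x →L[ℝ] TangentSpace I x →L[ℝ] ℝ) (x : M)
    (u v : TangentSpace I x) : coordMetric I g x (extChartAt I x x) u v = g x u v := by
  have hD := mfderivWithin_range_extChartAt_symm (I := I) (x := x)
  rw [I.range_eq_univ, mfderivWithin_univ] at hD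
  -- The type of `g y` depends on the base point, so the point and the derivative are generalized
  -- before substituting.
  have key (y : M) (hy : y = x) (D : E →L[ℝ] E) (hD' : D = ContinuousLinearMap.id ℝ E) :
      (g y : E →L[ℝ] E →L[ℝ] ℝ) (D u) (D v) = g x u v := by
    subst hy
    rw [hD']
    rfl
  exact key _ (extChartAt_to_inv x) _ hD

variable [FiniteDimensional ℝ E]
  {E' : Type*} [NormedAddCommGroup E'] [NormedSpace ℝ E'] [FiniteDimensional ℝ E']
  {H' : Type*} [TopologicalSpace H'] {I' : ModelWithCorners ℝ E' H'} [I'.Boundaryless]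
  {M' : Type*} [TopologicalSpace M'] [ChartedSpace H' M']

theorem ricciTensor_warpedMetric [IsManifold I ∞ M] [IsManifold I' ∞ M']
    (g₁ : ContMDiffRiemannianMetric I ∞ E (TangentSpace I : M → Type _))
    (g₂ : ContMDiffRiemannianMetric I' ∞ E' (TangentSpace I' : M' → Type _))
    {f : M → ℝ} (hf : ContMDiff I 𝓘(ℝ, ℝ) ∞ f) (x : M × M') (hfx : f x.1 ≠ 0) :
    ∃ c : ℝ, ∀ u v : TangentSpace (I.prod I') x,
      ricciTensor (I.prod I') (warpedMetric I I' g₁.inner g₂.inner f) x u v =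
        ricciTensor I g₁.inner x.1 u.1 v.1 + ricciTensor I' g₂.inner x.2 u.2 v.2
          - Module.finrank ℝ E' / f x.1 * hessian I g₁.inner f x.1 u.1 v.1
          + c * g₂.inner x.2 u.2 v.2 := by
  have : IsManifold I 1 M := .of_le (n := ∞) (by simp)
  have : IsManifold I' 1 M' := .of_le (n := ∞) (by simp)
  have h2 : (2 : ℕ∞ω) ≤ ∞ := WithTop.coe_le_coe.2 (le_top : (2 : ℕ∞) ≤ ⊤)
  have m₁ := mem_extChartAt_target (I := I) x.1
  have m₂ := mem_extChartAt_target (I := I') x.2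
  have hfx' : (f ∘ (extChartAt I x.1).symm) (extChartAt I x.1 x.1) = f x.1 := by simp
  have hF : ContDiffAt ℝ 2 (f ∘ (extChartAt I x.1).symm) (extChartAt I x.1 x.1) :=
    ((hf.contMDiffAt.comp _ ((contMDiffOn_extChartAt_symm x.1).contMDiffAt
      ((isOpen_extChartAt_target x.1).mem_nhds m₁))).contDiffAt).of_le h2
  obtain ⟨c, hc⟩ := coordRicci_warpedForm (z := (extChartAt I x.1 x.1, extChartAt I' x.2 x.2))
    ((contDiffAt_coordMetric g₁ m₁).of_le h2) ((contDiffAt_coordMetric g₂ m₂).of_le h2) hF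
    (isInvertible_coordMetric g₁.pos m₁) (isInvertible_coordMetric g₂.pos m₂)
    (fun z u v => g₂.symm _ _ _) (by rwa [hfx'])
  refine ⟨c, fun u v => ?_⟩
  have hev : coordMetric (I.prod I') (warpedMetric I I' g₁.inner g₂.inner f) x
      =ᶠ[nhds (extChartAt I x.1 x.1, extChartAt I' x.2 x.2)]
      warpedForm (coordMetric I g₁.inner x.1) (coordMetric I' g₂.inner x.2)
        (f ∘ (extChartAt I x.1).symm) := by
    filter_upwards [prod_mem_nhds ((isOpen_extChartAt_target x.1).mem_nhds m₁)
      ((isOpen_extChartAt_target x.2).mem_nhds m₂)] with z hz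
    exact coordMetric_warpedMetric _ _ _ _ hz.1 hz.2
  have hx : extChartAt (I.prod I') x x = (extChartAt I x.1 x.1, extChartAt I' x.2 x.2) := by
    simp
  rw [ricciTensor_apply, hx, coordRicci_congr hev, ricciTensor_apply _ x.1 u.1 v.1,
    ricciTensor_apply _ x.2 u.2 v.2, hessian_apply _ _ x.1 u.1 v.1,
    ← coordMetric_extChartAt_self g₂.inner x.2 u.2 v.2, ← hfx']
  exact hc u v

omit [I.Boundaryless] [FiniteDimensional ℝ E] [FiniteDimensional ℝ E'] [I'.Boundaryless] in
-- Pairing `u` with its own two components separates the factors, where positivity applies.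
theorem warpedMetric_nondegenerate {g₁ : ∀ x : M, TangentSpace I x →L[ℝ] TangentSpace I x →L[ℝ] ℝ}
    {g₂ : ∀ y : M', TangentSpace I' y →L[ℝ] TangentSpace I' y →L[ℝ] ℝ} {f : M → ℝ}
    (h₁ : ∀ x u, u ≠ 0 → 0 < g₁ x u u) (h₂ : ∀ y u, u ≠ 0 → 0 < g₂ y u u) {x : M × M'}
    (hfx : f x.1 ≠ 0) (u : TangentSpace (I.prod I') x)
    (hu : ∀ v, warpedMetric I I' g₁ g₂ f x u v = 0) : u = 0 := by
  have e₁ : g₁ x.1 u.1 u.1 + f x.1 ^ 2 * g₂ x.2 u.2 0 = 0 :=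
    (warpedMetric_apply g₁ g₂ f x u ((u.1, 0) : E × E')).symm.trans (hu _)
  have e₂ : g₁ x.1 u.1 0 + f x.1 ^ 2 * g₂ x.2 u.2 u.2 = 0 :=
    (warpedMetric_apply g₁ g₂ f x u ((0, u.2) : E × E')).symm.trans (hu _)
  rw [map_zero, mul_zero, add_zero] at e₁
  rw [map_zero, zero_add] at e₂
  refine Prod.ext ?_ ?_ <;> by_contra h
  · exact (h₁ _ _ h).ne' e₁
  · exact (h₂ _ _ h).ne' ((mul_eq_zero_iff_left (pow_ne_zero 2 hfx)).1 e₂)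

end Manifold

end

/-! ### The invariance criterion. -/

theorem mainTheorem3 (n m : ℕ) (hm : 1 ≤ m)
    {M₁ : Type*} [TopologicalSpace M₁] [ChartedSpace (EuclideanSpace ℝ (Fin n)) M₁]
    [IsManifold (𝓡 n) ∞ M₁]
    {M₂ : Type*} [TopologicalSpace M₂] [ChartedSpace (EuclideanSpace ℝ (Fin m)) M₂]
    [IsManifold (𝓡 m) ∞ M₂] [Nonempty M₂]
    (p q : ℕ)
    (g₁ : ContMDiffRiemannianMetric (𝓡 n) ∞ (EuclideanSpace ℝ (Fin n))
      (TangentSpace (𝓡 n) : M₁ → Type _))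
    (J₁ : ∀ x : M₁, TangentSpace (𝓡 n) x →L[ℝ] TangentSpace (𝓡 n) x)
    (hM₁ : IsMetallicRiemannian (𝓡 n) p q g₁ J₁)
    (g₂ : ContMDiffRiemannianMetric (𝓡 m) ∞ (EuclideanSpace ℝ (Fin m))
      (TangentSpace (𝓡 m) : M₂ → Type _))
    (J₂ : ∀ y : M₂, TangentSpace (𝓡 m) y →L[ℝ] TangentSpace (𝓡 m) y)
    (hM₂ : IsMetallicRiemannian (𝓡 m) p q g₂ J₂)
    (f : M₁ → ℝ) (hf : ContMDiff (𝓡 n) 𝓘(ℝ, ℝ) ∞ f) (hf_pos : ∀ x, 0 < f x)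
    (hRic₁ : HasInvariantRicci (𝓡 n) g₁.inner J₁)
    (hRic₂ : HasInvariantRicci (𝓡 m) g₂.inner J₂) :
    HasInvariantRicci ((𝓡 n).prod (𝓡 m))
        (warpedMetric (𝓡 n) (𝓡 m) g₁.inner g₂.inner f)
        (prodEndo (𝓡 n) (𝓡 m) J₁ J₂) ↔
      ∀ (x : M₁) (u v : TangentSpace (𝓡 n) x),
        hessian (𝓡 n) g₁.inner f x (J₁ x u) v - hessian (𝓡 n) g₁.inner f x u (J₁ x v) = 0 := by

  have : IsManifold (𝓡 n) 1 M₁ := .of_le (n := ∞) (by simp)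
  have : IsManifold (𝓡 m) 1 M₂ := .of_le (n := ∞) (by simp)
  have nd₁ (x) (u : TangentSpace (𝓡 n) x) (hu : ∀ v, g₁.inner x u v = 0) : u = 0 := by
    by_contra h
    exact (g₁.pos x u h).ne' (hu u)
  have nd₂ (y) (u : TangentSpace (𝓡 m) y) (hu : ∀ v, g₂.inner y u v = 0) : u = 0 := by
    by_contra h
    exact (g₂.pos y u h).ne' (hu u)
  have hS₁ (x) := (ricciOperator_comm_iff (nd₁ x) (hM₁.compatible x)).1 (hRic₁ x)
  have hS₂ (y) := (ricciOperator_comm_iff (nd₂ y) (hM₂.compatible y)).1 (hRic₂ y)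
  have hW (z : M₁ × M₂) := ricciOperator_comm_iff (I := (𝓡 n).prod (𝓡 m))
    (g := warpedMetric (𝓡 n) (𝓡 m) g₁.inner g₂.inner f) (J := prodEndo (𝓡 n) (𝓡 m) J₁ J₂)
    (warpedMetric_nondegenerate g₁.pos g₂.pos (hf_pos z.1).ne') (fun u v => by
      rw [warpedMetric_apply, warpedMetric_apply]
      exact congrArg₂ (· + f z.1 ^ 2 * ·) (hM₁.compatible z.1 u.1 v.1)
        (hM₂.compatible z.2 u.2 v.2))
  have hdiff (z : M₁ × M₂) (u v : TangentSpace ((𝓡 n).prod (𝓡 m)) z) :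
      ricciTensor ((𝓡 n).prod (𝓡 m)) (warpedMetric (𝓡 n) (𝓡 m) g₁.inner g₂.inner f) z
          (prodEndo (𝓡 n) (𝓡 m) J₁ J₂ z u) v =
        ricciTensor ((𝓡 n).prod (𝓡 m)) (warpedMetric (𝓡 n) (𝓡 m) g₁.inner g₂.inner f) z
          u (prodEndo (𝓡 n) (𝓡 m) J₁ J₂ z v) ↔
      hessian (𝓡 n) g₁.inner f z.1 (J₁ z.1 u.1) v.1 -
        hessian (𝓡 n) g₁.inner f z.1 u.1 (J₁ z.1 v.1) = 0 := by
    obtain ⟨c, hc⟩ := ricciTensor_warpedMetric g₁ g₂ hf z (hf_pos z.1).ne'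
    have key {r t a b g k l : ℝ} (hg : g ≠ 0) :
        r + t - g * a + k * l = r + t - g * b + k * l ↔ a - b = 0 := by
      rw [add_left_inj, sub_right_inj, mul_right_inj' hg, sub_eq_zero]
    -- The coefficient of the Hessian must be cancelled: this is where `1 ≤ m` enters.
    have hm' : (m : ℝ) / f z.1 ≠ 0 :=
      div_ne_zero (by exact_mod_cast (by omega : m ≠ 0)) (hf_pos z.1).ne'
    rw [hc, hc, finrank_euclideanSpace_fin]
    -- Moving `J₁` and `J₂` across in the S₁, S₂ and g₂ terms leaves two sides that differ only in
    -- the Hessian.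
    refine Iff.trans (Eq.congr_left ?_) (key hm')
    exact congrArg₂ (· + c * ·) (congrArg (· - _) (congrArg₂ (· + ·) (hS₁ z.1 u.1 v.1)
      (hS₂ z.2 u.2 v.2))) (hM₂.compatible z.2 u.2 v.2)
  constructor
  · intro h x u v
    -- Any point of the fibre over `x` will do, with horizontal vectors as test vectors.
    obtain ⟨y⟩ := ‹Nonempty M₂›
    exact (hdiff (x, y) (u, 0) (v, 0)).1 ((hW (x, y)).1 (h (x, y)) _ _)
  · intro h z
    exact (hW z).2 fun u v => (hdiff z u v).2 (h _ _ _)
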